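/- Let $A\in\mathbb{R}^{m\times n}$ and $b\in\mathbb{R}^m$ be such that $Ax=b$ has a solution. Write $\|x\|_0$ for the number of nonzero entries of $x$, $\|x\|$ for its Euclidean norm, and $|x|_{[1]}\ge\dots\ge|x|_{[n]}$ for the absolute values of the entries of $x\in\mathbb{R}^n$ in nonincreasing order. For an integer $k\ge 0$ let $\delta_k$ be the restricted isometry constant of $A$ of order $k$, i.e. the smallest number $\delta\ge 0$ such that $$(1-\delta)\|x\|^2\le\|Ax\|^2\le(1+\delta)\|x\|^2\quad\text{for all } x\in\mathbb{R}^n \text{ with } \|x\|_0\le k,$$ and put $\delta_s:=\delta_{\lceil s\rceil}$ for real $s\ge 0$. Let $K=\min\{\|x\|_0: Ax=b\}$, let $q\in(0,1]$, and let $r$ be an integer with $0\le r\le K$. Assume that at least one of the following holds: (a) $K+\lfloor r/2\rfloor\ge 2$ and $\delta_{K+\lfloor r/2\rfloor}<\dfrac13$; (b) $\delta_{\gamma(K+\lfloor r/2\rfloor)}<\dfrac{1}{\sqrt{(\gamma-1)^{1-2/q}+1}}$ for some real $\gamma>1$. Then every sparsest solution $x^*$ of $Ax=b$ (that is, $Ax^*=b$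 and $\|x^*\|_0=K$) is the unique global minimizer of $$\min_{x\in\mathbb{R}^n}\Big\{\sum_{i=r+1}^n|x|_{[i]}^q:\ Ax=b\Big\}.$$ -/

import Mathlib

noncomputable section

namespace PartialLq

/-- `δ ≥ 0` is an admissible restricted isometry bound of order `k` for `A`: one has
`(1 - δ)‖x‖² ≤ ‖A x‖² ≤ (1 + δ)‖x‖²` (Euclidean norms) for every `k`-sparse `x`.
If some nonzero `x` is `k`-sparse, the two inequalities force `δ ≥ 0`; the explicit
requirement matters only when there is no such vector (`k = 0` or `n = 0`). -/
def IsRIBound {m n : ℕ} (A : Matrix (Fin m) (Fin n) ℝ) (k : ℕ) (δ : ℝ) : Prop :=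
  0 ≤ δ ∧ ∀ x : Fin n → ℝ, hammingNorm x ≤ k →
    (1 - δ) * ‖WithLp.toLp 2 x‖ ^ 2 ≤ ‖WithLp.toLp 2 (A.mulVec x)‖ ^ 2 ∧
      ‖WithLp.toLp 2 (A.mulVec x)‖ ^ 2 ≤ (1 + δ) * ‖WithLp.toLp 2 x‖ ^ 2

/-- The restricted isometry constant of order `k`: the smallest admissible bound. -/
def ric {m n : ℕ} (A : Matrix (Fin m) (Fin n) ℝ) (k : ℕ) : ℝ :=
  sInf {δ : ℝ | IsRIBound A k δ}

/-- The restricted isometry constant of real order `s`, by rounding the order up. -/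
def ricReal {m n : ℕ} (A : Matrix (Fin m) (Fin n) ℝ) (s : ℝ) : ℝ :=
  ric A ⌈s⌉₊

/-- `K = min {‖x‖₀ : A x = b}`. -/
def minCard {m n : ℕ} (A : Matrix (Fin m) (Fin n) ℝ) (b : Fin m → ℝ) : ℕ :=
  sInf {k : ℕ | ∃ x : Fin n → ℝ, A.mulVec x = b ∧ hammingNorm x = k}

/-- `x` is a sparsest solution of `A x = b`. -/
def IsSparsestSolution {m n : ℕ} (A : Matrix (Fin m) (Fin n) ℝ) (b : Fin m → ℝ)
    (x : Fin n → ℝ) : Prop :=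
  A.mulVec x = b ∧ ∀ y : Fin n → ℝ, A.mulVec y = b → hammingNorm x ≤ hammingNorm y

/-- The absolute values of the entries of `x` in nonincreasing order; `absSorted x i` is the
`(i+1)`-st largest of them, since indices start at `0`. -/
def absSorted {n : ℕ} (x : Fin n → ℝ) : Fin n → ℝ :=
  fun i => |x (Tuple.sort (fun j => -|x j|) i)|

/-- The partial regularizer: the sum of `φ` over all but the `r` largest absolute values. -/
def partialReg {n : ℕ} (φ : ℝ → ℝ) (r : ℕ) (x : Fin n → ℝ) : ℝ :=
  ∑ i ∈ Finset.univ.filter (fun i : Fin n => r ≤ i.val), φ (absSorted x i)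

/-- `x` is the unique global minimizer of `partialReg φ r` subject to `A x = b`. -/
def IsUniqueGlobalMin {m n : ℕ} (A : Matrix (Fin m) (Fin n) ℝ) (b : Fin m → ℝ)
    (φ : ℝ → ℝ) (r : ℕ) (x : Fin n → ℝ) : Prop :=
  A.mulVec x = b ∧
    ∀ y : Fin n → ℝ, A.mulVec y = b → y ≠ x → partialReg φ r x < partialReg φ r y

theorem absSorted_antitone {n : ℕ} (x : Fin n → ℝ) : Antitone (absSorted x) := by
  intro i j hij
  have h := Tuple.monotone_sort (fun j => -|x j|) hij
  simp only [Function.comp_apply] at h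
  exact neg_le_neg_iff.mp h

/-- The infimum in `ric` is attained: `ric A k` is the smallest admissible bound. -/
theorem ric_isLeast {m n : ℕ} (A : Matrix (Fin m) (Fin n) ℝ) (k : ℕ) :
    IsLeast {δ : ℝ | IsRIBound A k δ} (ric A k) := by
  have hbdd : BddBelow {δ : ℝ | IsRIBound A k δ} := ⟨0, fun δ hδ => hδ.1⟩
  have hclosed : IsClosed {δ : ℝ | IsRIBound A k δ} := by
    have he : {δ : ℝ | IsRIBound A k δ} = {δ : ℝ | 0 ≤ δ} ∩
        ⋂ (x : Fin n → ℝ) (_ : hammingNorm x ≤ k),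
          ({δ : ℝ | (1 - δ) * ‖WithLp.toLp 2 x‖ ^ 2 ≤ ‖WithLp.toLp 2 (A.mulVec x)‖ ^ 2} ∩
            {δ : ℝ | ‖WithLp.toLp 2 (A.mulVec x)‖ ^ 2 ≤ (1 + δ) * ‖WithLp.toLp 2 x‖ ^ 2}) := by
      ext δ
      simp [IsRIBound]
    rw [he]
    refine IsClosed.inter (isClosed_le (by fun_prop) (by fun_prop))
      (isClosed_iInter fun x => isClosed_iInter fun _ => IsClosed.inter
        (isClosed_le (by fun_prop) (by fun_prop)) (isClosed_le (by fun_prop) (by fun_prop)))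
  have hne : {δ : ℝ | IsRIBound A k δ}.Nonempty := by
    let L := (Matrix.toEuclideanLin A).toContinuousLinearMap
    refine ⟨1 + ‖L‖ ^ 2, by positivity, fun x _ => ⟨?_, ?_⟩⟩
    · nlinarith [sq_nonneg (‖L‖ * ‖WithLp.toLp 2 x‖), sq_nonneg ‖WithLp.toLp 2 (A.mulVec x)‖]
    · have h : ‖WithLp.toLp 2 (A.mulVec x)‖ ≤ ‖L‖ * ‖WithLp.toLp 2 x‖ :=
        L.le_opNorm (WithLp.toLp 2 x)
      have h2 := pow_le_pow_left₀ (norm_nonneg _) h 2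
      nlinarith [sq_nonneg ‖WithLp.toLp 2 x‖]
  exact ⟨hclosed.csInf_mem hne hbdd, fun δ hδ => csInf_le hbdd hδ⟩

end PartialLq

end

/-! Let `y` be another solution and `h = y - x`, a nonzero kernel vector. Everything reduces to the
null space property of order `K`: on every set of at most `K` indices the `ℓ^q` mass of `h` is
strictly below its mass on the complement. `partialReg_rpow_lt` shows that this one property serves
every `r ≤ K`, by an exchange between the support of `x` and the `r` largest entries of `y`. Hence
restricted isometry of order `K`, respectively `⌈γK⌉`, already suffices, and the hypotheses give it
by monotonicity in the order.

The property need only be checked on the set `T` of the `K` largest entries. If it fails there, the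
tail of `h`, after scaling in case (a) or removal of its few large entries in case (b), lies in a
polytope `‖v‖_∞ ≤ β`, `‖v‖₁ ≤ sβ`, hence in the convex hull of `s`-sparse vectors
(`mem_convexHull_sparse`). `IsRIBound.cross_le` carries the isometry bounds over to that hull. As `A
h = 0`, the image of the tail is minus the image of the head, and suitable weights in `cross_le`
give a contradiction below each threshold. -/

namespace PartialLq

open Finset

variable {ι : Type*}

/-! ### Extremal subsets of prescribed size. -/

/-- Every finite set contains a subset of prescribed size on which `f` is largest. -/
theorem exists_subset_card_eq_forall_le (f : ι → ℝ) (s : Finset ι) :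
    ∀ k ≤ #s, ∃ t ⊆ s, #t = k ∧ ∀ i ∈ t, ∀ j ∈ s, j ∉ t → f j ≤ f i := by
  classical
  intro k
  induction k with
  | zero => exact fun _ => ⟨∅, by simp, by simp, by simp⟩
  | succ k ih =>
    intro hk
    obtain ⟨t, hts, htk, ht⟩ := ih (by omega)
    have hne : (s \ t).Nonempty := by
      rw [← card_pos, card_sdiff_of_subset hts]
      omega
    obtain ⟨a, ha, hmax⟩ := exists_max_image (s \ t) f hne
    rw [mem_sdiff] at ha
    refine ⟨insert a t, insert_subset ha.1 hts, by rw [card_insert_of_notMem ha.2, htk], ?_⟩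
    intro i hi j hj hjt
    rw [mem_insert, not_or] at hjt
    rcases mem_insert.1 hi with rfl | hi
    · exact hmax j (mem_sdiff.2 ⟨hj, hjt.2⟩)
    · exact ht i hi j hj hjt.2

/-- A set on which `f` is largest has the largest sum among all sets that are not larger. -/
theorem sum_le_sum_of_forall_le [DecidableEq ι] {f : ι → ℝ} (hf : ∀ i, 0 ≤ f i) {t u : Finset ι}
    (hut : #u ≤ #t) (ht : ∀ i ∈ t, ∀ j ∉ t, f j ≤ f i) : ∑ i ∈ u, f i ≤ ∑ i ∈ t, f i := by
  rw [← sum_inter_add_sum_sdiff u t f, ← sum_inter_add_sum_sdiff t u f, inter_comm t u]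
  have hcard : #(u \ t) ≤ #(t \ u) := by
    have h1 := card_inter_add_card_sdiff u t
    have h2 := card_inter_add_card_sdiff t u
    rw [inter_comm t u] at h2
    omega
  have hsum : ∑ i ∈ u \ t, f i ≤ ∑ i ∈ t \ u, f i := by
    rcases (t \ u).eq_empty_or_nonempty with he | hne
    · have : u \ t = ∅ := by
        rw [← card_eq_zero]
        rw [he, card_empty] at hcard
        omega
      rw [this, he]
    · obtain ⟨c, hc, hmin⟩ := exists_min_image (t \ u) f hne
      calc ∑ i ∈ u \ t, f i ≤ #(u \ t) • f c :=
            sum_le_card_nsmul _ _ _ fun j hj =>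
              ht c (mem_sdiff.1 hc).1 j (mem_sdiff.1 hj).2
        _ ≤ #(t \ u) • f c := nsmul_le_nsmul_left (hf c) hcard
        _ ≤ ∑ i ∈ t \ u, f i := card_nsmul_le_sum _ _ _ hmin
  linarith

/-- Some subset of prescribed size has at most the average weight. -/
theorem exists_subset_card_eq_card_mul_sum_le (f : ι → ℝ) (s : Finset ι) {k : ℕ} (hk : k ≤ #s) :
    ∃ t ⊆ s, #t = k ∧ (#s : ℝ) * ∑ i ∈ t, f i ≤ k * ∑ i ∈ s, f i := by
  classical
  obtain ⟨t, hts, htk, ht⟩ := exists_subset_card_eq_forall_le (fun i => -f i) s k hk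
  refine ⟨t, hts, htk, ?_⟩
  have hle : ∑ i ∈ t, ∑ j ∈ s \ t, f i ≤ ∑ i ∈ t, ∑ j ∈ s \ t, f j := by
    refine sum_le_sum fun i hi => sum_le_sum fun j hj => ?_
    have := ht i hi j (mem_sdiff.1 hj).1 (mem_sdiff.1 hj).2
    linarith
  simp only [sum_const, nsmul_eq_mul, ← mul_sum] at hle
  have hc : (#(s \ t) : ℝ) = #s - k := by
    rw [card_sdiff_of_subset hts, Nat.cast_sub (card_le_card hts), htk]
  rw [hc, htk] at hle
  have := sum_sdiff (f := f) hts
  rw [← this]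
  nlinarith

/-! ### Sparse convex decomposition. -/

variable [Fintype ι] [DecidableEq ι]

/-- Sparse representation of the polytope `‖v‖_∞ ≤ β`, `‖v‖₁ ≤ s β`: its elements are convex
combinations of `s`-sparse vectors with entries bounded by `β` and no larger support. -/
theorem mem_convexHull_sparse (s : ℕ) (β : ℝ) (v : ι → ℝ) (hv : ∀ i, |v i| ≤ β)
    (hsum : ∑ i, |v i| ≤ s * β) :
    v ∈ convexHull ℝ {u : ι → ℝ | hammingNorm u ≤ s ∧ (∀ i, |u i| ≤ β) ∧
      ∀ i, v i = 0 → u i = 0} := by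
  induction hN : #{i | v i ≠ 0 ∧ |v i| ≠ β} using Nat.strong_induction_on generalizing v with
  | _ N ih =>
  by_cases hfew : N ≤ 1
  -- With at most one nonzero entry off `±β`, more than `s` nonzero entries would give at least `s`
  -- entries of modulus `β` and one further positive one, exceeding `s * β`.
  · refine subset_convexHull ℝ _ ⟨?_, hv, fun i h => h⟩
    by_contra! hlt
    have hne : ({i | v i ≠ 0} : Finset ι).Nonempty := by
      rw [← card_pos]
      exact lt_of_le_of_lt (Nat.zero_le s) hlt
    have hlarge : s * β < ∑ i with v i ≠ 0, |v i| := by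
      have hβ : 0 < β := by
        obtain ⟨i, hi⟩ := hne
        exact (abs_pos.2 (mem_filter.1 hi).2).trans_le (hv i)
      obtain ⟨i, hi, hie⟩ : ∃ i, v i ≠ 0 ∧ ∀ j, j ≠ i → v j ≠ 0 → |v j| = β := by
        by_cases hz : ∃ i, v i ≠ 0 ∧ |v i| ≠ β
        · obtain ⟨i, hi⟩ := hz
          refine ⟨i, hi.1, fun j hj hj0 => ?_⟩
          by_contra hjβ
          exact hj (card_le_one.1 (hN.trans_le hfew) j (by simp [hj0, hjβ]) i (by simp [hi]))
        · push Not at hz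
          obtain ⟨i, hi⟩ := hne
          exact ⟨i, (mem_filter.1 hi).2, fun j _ hj => hz j hj⟩
      rw [← add_sum_erase _ _ (show i ∈ ({i | v i ≠ 0} : Finset ι) by simp [hi]),
        sum_congr rfl (g := fun _ => β) (fun j hj => by
          rw [mem_erase, mem_filter] at hj
          exact hie j hj.1 hj.2.2), sum_const, nsmul_eq_mul,
        card_erase_of_mem (by simp [hi])]
      have : (s : ℝ) ≤ ((#{i | v i ≠ 0} - 1 : ℕ) : ℝ) := by
        exact_mod_cast Nat.le_sub_one_of_lt hlt
      nlinarith [abs_pos.2 hi]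
    have hle : ∑ i with v i ≠ 0, |v i| ≤ ∑ i, |v i| :=
      sum_le_sum_of_subset_of_nonneg (filter_subset _ _) fun _ _ _ => abs_nonneg _
    linarith
  · obtain ⟨i, hi, j, hj, hij⟩ := one_lt_card.1 (show 1 < #{i | v i ≠ 0 ∧ |v i| ≠ β} by omega)
    simp only [mem_filter, mem_univ, true_and] at hi hj
    set a := |v i| with ha
    set b := |v j| with hb
    have ha0 : 0 < a := abs_pos.2 hi.1
    have hb0 : 0 < b := abs_pos.2 hj.1
    have haβ : a < β := lt_of_le_of_ne (hv i) hi.2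
    have hbβ : b < β := lt_of_le_of_ne (hv j) hj.2
    -- Signs are kept and the moduli at `i`, `j` become `c`, `d`. Keeping `c + d = a + b` preserves
    -- the `ℓ¹` norm, and pushing one modulus to `0` or `β` lowers the induction count.
    let w : ℝ → ℝ → ι → ℝ := fun c d x =>
      if x = i then SignType.sign (v i) * c else if x = j then SignType.sign (v j) * d else v x
    have habs : ∀ t : ℝ, t ≠ 0 → ∀ c : ℝ, 0 ≤ c → |(SignType.sign t : ℝ) * c| = c := by
      intro t ht c hc
      rcases lt_or_gt_of_ne ht with h | h
      · simp [sign_neg h, abs_of_nonneg hc]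
      · simp [sign_pos h, abs_of_nonneg hc]
    have hwi : ∀ c d, 0 ≤ c → |w c d i| = c := fun c d hc => by
      simp only [w, if_true]
      exact habs _ hi.1 c hc
    have hwj : ∀ c d, 0 ≤ d → |w c d j| = d := fun c d hd => by
      simp only [w, if_neg hij.symm, if_true]
      exact habs _ hj.1 d hd
    have hwx : ∀ c d x, x ≠ i → x ≠ j → w c d x = v x := fun c d x h1 h2 => by
      simp only [w, if_neg h1, if_neg h2]
    have key : ∀ c d, c + d = a + b → 0 ≤ c → 0 ≤ d → c ≤ β → d ≤ β →
        ((c = 0 ∨ c = β) ∨ (d = 0 ∨ d = β)) →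
        w c d ∈ convexHull ℝ {u : ι → ℝ | hammingNorm u ≤ s ∧ (∀ i, |u i| ≤ β) ∧
          ∀ i, v i = 0 → u i = 0} := by
      intro c d hcd hc hd hcβ hdβ hend
      have hzero : ∀ x, v x = 0 → w c d x = 0 := by
        intro x hx
        rw [hwx c d x (by rintro rfl; exact hi.1 hx) (by rintro rfl; exact hj.1 hx), hx]
      have hmem := ih _ ?_ (w c d) ?_ ?_ rfl
      · refine convexHull_mono ?_ hmem
        exact fun u hu => ⟨hu.1, hu.2.1, fun x hx => hu.2.2 x (hzero x hx)⟩
      · rw [← hN]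
        refine card_lt_card ⟨fun x hx => ?_, fun hsub => ?_⟩
        · simp only [mem_filter, mem_univ, true_and] at hx ⊢
          by_cases hxi : x = i
          · rw [hxi]; exact hi
          by_cases hxj : x = j
          · rw [hxj]; exact hj
          rwa [hwx c d x hxi hxj] at hx
        · have h1 := hsub (show i ∈ _ by simpa using hi)
          have h2 := hsub (show j ∈ _ by simpa using hj)
          simp only [mem_filter, mem_univ, true_and, ← abs_pos (a := w c d _), hwi c d hc,
            hwj c d hd] at h1 h2
          rcases hend with (h | h) | (h | h)
          · exact h1.1.ne' h
          · exact h1.2 h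
          · exact h2.1.ne' h
          · exact h2.2 h
      · intro x
        by_cases hxi : x = i
        · rw [hxi, hwi c d hc]; exact hcβ
        by_cases hxj : x = j
        · rw [hxj, hwj c d hd]; exact hdβ
        rw [hwx c d x hxi hxj]; exact hv x
      · have hsplit : ∀ x, |w c d x| =
            |v x| + ((if x = i then c - a else 0) + (if x = j then d - b else 0)) := by
          intro x
          by_cases hxi : x = i
          · rw [hxi, hwi c d hc, if_pos rfl, if_neg hij]; ring
          by_cases hxj : x = j
          · rw [hxj, hwj c d hd, if_pos rfl, if_neg hij.symm]; ring
          rw [hwx c d x hxi hxj, if_neg hxi, if_neg hxj]; ring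
        simp only [hsplit, sum_add_distrib, sum_ite_eq', mem_univ, if_true]
        linarith
    -- `M` is the most mass that one of the two entries can take; `v` lies on the segment between
    -- the two extreme transfers.
    set M := min (a + b) β with hM
    have hMa : a ≤ M := le_min (by linarith) haβ.le
    have hMb : b ≤ M := le_min (by linarith) hbβ.le
    have hMs : M ≤ a + b := min_le_left _ _
    have hMβ : M ≤ β := min_le_right _ _
    have hMM : a + b < 2 * M := by
      rcases min_choice (a + b) β with h | h <;> rw [hM, h] <;> linarith
    have hend : a + b - M = 0 ∨ M = β := by
      rcases min_choice (a + b) β with h | h <;> rw [hM, h] <;> simp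
    have h1 := key M (a + b - M) (by ring) (by linarith) (by linarith) hMβ (by linarith)
      (by tauto)
    have h2 := key (a + b - M) M (by ring) (by linarith) (by linarith) (by linarith) hMβ
      (by tauto)
    obtain ⟨θ, hθ0, hθ1, hθ⟩ : ∃ θ : ℝ, 0 ≤ θ ∧ θ ≤ 1 ∧ θ * M + (1 - θ) * (a + b - M) = a := by
      have hden : 0 < 2 * M - (a + b) := by linarith
      refine ⟨(M - b) / (2 * M - (a + b)), div_nonneg (by linarith) hden.le,
        (div_le_one hden).2 (by linarith), ?_⟩
      have := div_mul_cancel₀ (M - b) hden.ne'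
      linear_combination this
    have hv_eq : θ • w M (a + b - M) + (1 - θ) • w (a + b - M) M = v := by
      ext x
      simp only [Pi.add_apply, Pi.smul_apply, smul_eq_mul]
      by_cases hxi : x = i
      · have : SignType.sign (v i) * a = v i := sign_mul_abs (v i)
        simp only [hxi, w, if_true]
        linear_combination this + SignType.sign (v i) * hθ
      by_cases hxj : x = j
      · have : SignType.sign (v j) * b = v j := sign_mul_abs (v j)
        simp only [hxj, w, if_true, if_neg hij.symm]
        linear_combination this - SignType.sign (v j) * hθ
      rw [hwx _ _ x hxi hxj, hwx _ _ x hxi hxj]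
      ring
    have hcomb := (convex_convexHull ℝ _) h1 h2 hθ0 (by linarith : 0 ≤ 1 - θ) (by ring)
    rwa [hv_eq] at hcomb

end PartialLq

namespace PartialLq

open Finset Matrix

variable {m n : ℕ}

/-! ### Restrictions of vectors and restricted isometry estimates. -/

/-- The restriction of a vector to a set of coordinates. -/
def restrictTo (T : Finset (Fin n)) (h : Fin n → ℝ) : Fin n → ℝ :=
  fun i => if i ∈ T then h i else 0

theorem restrictTo_of_mem {T : Finset (Fin n)} {i : Fin n} (hi : i ∈ T) (h : Fin n → ℝ) :
    restrictTo T h i = h i := if_pos hi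

theorem restrictTo_of_notMem {T : Finset (Fin n)} {i : Fin n} (hi : i ∉ T) (h : Fin n → ℝ) :
    restrictTo T h i = 0 := if_neg hi

theorem restrictTo_dotProduct (T : Finset (Fin n)) (h g : Fin n → ℝ) :
    restrictTo T h ⬝ᵥ g = ∑ i ∈ T, h i * g i := by
  simp [dotProduct, restrictTo, ite_mul, sum_ite_mem]

theorem restrictTo_dotProduct_self (T : Finset (Fin n)) (h : Fin n → ℝ) :
    restrictTo T h ⬝ᵥ restrictTo T h = ∑ i ∈ T, h i ^ 2 := by
  rw [restrictTo_dotProduct]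
  exact sum_congr rfl fun i hi => by rw [restrictTo_of_mem hi, sq]

theorem sum_abs_restrictTo (T : Finset (Fin n)) (h : Fin n → ℝ) :
    ∑ i, |restrictTo T h i| = ∑ i ∈ T, |h i| := by
  simp [restrictTo, apply_ite abs, sum_ite_mem]

theorem restrictTo_add_restrictTo_compl (T : Finset (Fin n)) (h : Fin n → ℝ) :
    restrictTo T h + restrictTo Tᶜ h = h := by
  ext i
  by_cases hi : i ∈ T <;> simp [restrictTo, hi]

theorem hammingNorm_le_card {x : Fin n → ℝ} {T : Finset (Fin n)} (h : ∀ i ∉ T, x i = 0) :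
    hammingNorm x ≤ #T := by
  refine card_le_card fun i hi => ?_
  by_contra hiT
  exact (mem_filter.1 hi).2 (h i hiT)

theorem norm_toLp_sq (x : Fin n → ℝ) : ‖WithLp.toLp 2 x‖ ^ 2 = x ⬝ᵥ x := by
  rw [EuclideanSpace.real_norm_sq_eq]
  simp [dotProduct, sq]

theorem isRIBound_iff {A : Matrix (Fin m) (Fin n) ℝ} {k : ℕ} {δ : ℝ} :
    IsRIBound A k δ ↔ 0 ≤ δ ∧ ∀ x : Fin n → ℝ, hammingNorm x ≤ k →
      (1 - δ) * (x ⬝ᵥ x) ≤ A *ᵥ x ⬝ᵥ A *ᵥ x ∧ A *ᵥ x ⬝ᵥ A *ᵥ x ≤ (1 + δ) * (x ⬝ᵥ x) := by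
  simp only [IsRIBound, norm_toLp_sq]

theorem IsRIBound.mono {A : Matrix (Fin m) (Fin n) ℝ} {k l : ℕ} {δ : ℝ} (hA : IsRIBound A l δ)
    (hkl : k ≤ l) : IsRIBound A k δ :=
  ⟨hA.1, fun x hx => hA.2 x (hx.trans hkl)⟩

/-- A restricted isometry estimate for a sparse vector `p` against a vector `v` with disjoint
support in the polytope `‖v‖_∞ ≤ β`, `‖v‖₁ ≤ s β`. -/
theorem IsRIBound.cross_le {A : Matrix (Fin m) (Fin n) ℝ} {N : ℕ} {δ : ℝ} (hA : IsRIBound A N δ)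
    {P : Finset (Fin n)} {p v : Fin n → ℝ} {s : ℕ} {β : ℝ} (hPs : #P + s ≤ N)
    (hp : ∀ i ∉ P, p i = 0) (hvP : ∀ i ∈ P, v i = 0) (hv : ∀ i, |v i| ≤ β)
    (hsum : ∑ i, |v i| ≤ s * β) (x y z : ℝ) :
    (x ^ 2 - y ^ 2) * (A *ᵥ p ⬝ᵥ A *ᵥ p) - 2 * z * (x + y) * (A *ᵥ p ⬝ᵥ A *ᵥ v) ≤
      (x ^ 2 - y ^ 2 + δ * (x ^ 2 + y ^ 2)) * (p ⬝ᵥ p) + 2 * δ * z ^ 2 * (s * β ^ 2) := by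
  obtain ⟨hδ, hA⟩ := isRIBound_iff.1 hA
  have hmem := mem_convexHull_sparse s β v hv hsum
  -- The bound to be proved is affine in `v`, so it defines a half-space and need only be verified
  -- at the sparse vectors `u`.
  have hlin : IsLinearMap ℝ fun u : Fin n → ℝ =>
      -(2 * z * (x + y)) * (A *ᵥ p ⬝ᵥ A *ᵥ u) := by
    constructor
    · intro u w
      rw [mulVec_add, dotProduct_add, mul_add]
    · intro c u
      rw [mulVec_smul, dotProduct_smul, smul_eq_mul, smul_eq_mul]
      ring
  have hconv := convex_halfSpace_le hlin
    ((x ^ 2 - y ^ 2 + δ * (x ^ 2 + y ^ 2)) * (p ⬝ᵥ p) + 2 * δ * z ^ 2 * (s * β ^ 2) -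
      (x ^ 2 - y ^ 2) * (A *ᵥ p ⬝ᵥ A *ᵥ p))
  have hsub := convexHull_min ?_ hconv hmem
  · simp only [Set.mem_ofPred_eq] at hsub
    linarith
  rintro u ⟨hus, huβ, huv⟩
  simp only [Set.mem_ofPred_eq]
  have horth : p ⬝ᵥ u = 0 := by
    refine sum_eq_zero fun i _ => ?_
    by_cases hi : i ∈ P
    · rw [huv i (hvP i hi), mul_zero]
    · rw [hp i hi, zero_mul]
  have huu : u ⬝ᵥ u ≤ s * β ^ 2 := by
    have h1 : u ⬝ᵥ u = ∑ i with u i ≠ 0, u i ^ 2 := by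
      rw [sum_filter]
      refine sum_congr rfl fun i _ => ?_
      by_cases hi : u i = 0 <;> simp [hi, sq]
    have h2 : ∑ i with u i ≠ 0, u i ^ 2 ≤ hammingNorm u • β ^ 2 :=
      sum_le_card_nsmul _ _ _ fun i _ => sq_le_sq.2 ((huβ i).trans (le_abs_self β))
    rw [nsmul_eq_mul] at h2
    have h3 : (hammingNorm u : ℝ) ≤ s := by exact_mod_cast hus
    nlinarith [sq_nonneg β]
  have hsparse : ∀ c d : ℝ, hammingNorm (c • p + d • u) ≤ N := by
    intro c d
    refine (hammingNorm_le_card (T := P ∪ ({i | u i ≠ 0} : Finset (Fin n))) fun i hi => ?_).trans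
      ((card_union_le _ _).trans ((Nat.add_le_add_left hus _).trans hPs))
    simp only [mem_union, mem_filter, mem_univ, true_and, not_or, not_not] at hi
    simp [hp i hi.1, hi.2]
  have hexp : ∀ c d : ℝ, (c • p + d • u) ⬝ᵥ (c • p + d • u) =
      c ^ 2 * (p ⬝ᵥ p) + d ^ 2 * (u ⬝ᵥ u) := by
    intro c d
    simp only [add_dotProduct, dotProduct_add, smul_dotProduct, dotProduct_smul, smul_eq_mul,
      dotProduct_comm u p, horth]
    ring
  have hexpA : ∀ c d : ℝ, A *ᵥ (c • p + d • u) ⬝ᵥ A *ᵥ (c • p + d • u) =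
      c ^ 2 * (A *ᵥ p ⬝ᵥ A *ᵥ p) + 2 * c * d * (A *ᵥ p ⬝ᵥ A *ᵥ u) +
        d ^ 2 * (A *ᵥ u ⬝ᵥ A *ᵥ u) := by
    intro c d
    simp only [mulVec_add, mulVec_smul, add_dotProduct, dotProduct_add, smul_dotProduct,
      dotProduct_smul, smul_eq_mul, dotProduct_comm (A *ᵥ u) (A *ᵥ p)]
    ring
  -- Using the upper bound at `x p - z u` and the lower bound at `y p + z u` makes the quadratic
  -- terms in `A u` cancel.
  have hup := (hA _ (hsparse x (-z))).2
  have hlow := (hA _ (hsparse y z)).1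
  rw [hexp, hexpA] at hup hlow
  have hz : 2 * δ * z ^ 2 * (u ⬝ᵥ u) ≤ 2 * δ * z ^ 2 * (s * β ^ 2) :=
    mul_le_mul_of_nonneg_left huu (by positivity)
  linarith

/-! ### From `ℓ^q` to `ℓ¹` masses. -/

theorem abs_le_rpow_mul_abs_rpow {q c t : ℝ} (hq1 : q ≤ 1) (ht : |t| ≤ c) :
    |t| ≤ c ^ (1 - q) * |t| ^ q := by
  calc |t| = |t| ^ (1 - q) * |t| ^ q := by
        rw [← Real.rpow_add' (abs_nonneg t) (by norm_num), sub_add_cancel, Real.rpow_one]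
    _ ≤ c ^ (1 - q) * |t| ^ q := by gcongr

theorem rpow_mul_abs_rpow_le_abs {q c t : ℝ} (hq1 : q ≤ 1) (hc : 0 ≤ c) (ht : c ≤ |t|) :
    c ^ (1 - q) * |t| ^ q ≤ |t| := by
  calc c ^ (1 - q) * |t| ^ q ≤ |t| ^ (1 - q) * |t| ^ q := by gcongr
    _ = |t| := by
        rw [← Real.rpow_add' (abs_nonneg t) (by norm_num), sub_add_cancel, Real.rpow_one]

/-- If the `ℓ^q` mass of the largest entries dominates for some `q ≤ 1`, so does the `ℓ¹` mass. -/
theorem sum_abs_compl_le_of_sum_rpow_compl_le {q : ℝ} (hq1 : q ≤ 1) {h : Fin n → ℝ}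
    {T : Finset (Fin n)} (hne : T.Nonempty) (hT : ∀ i ∈ T, ∀ j ∉ T, |h j| ≤ |h i|)
    (hle : ∑ i ∈ Tᶜ, |h i| ^ q ≤ ∑ i ∈ T, |h i| ^ q) :
    ∑ i ∈ Tᶜ, |h i| ≤ ∑ i ∈ T, |h i| := by
  -- The smallest modulus on `T` separates `T` from its complement, so the same factor `|h c| ^ (1 -
  -- q)` compares both masses with their `ℓ¹` counterparts.
  obtain ⟨c, hc, hmin⟩ := exists_min_image T (fun i => |h i|) hne
  calc ∑ i ∈ Tᶜ, |h i| ≤ ∑ i ∈ Tᶜ, |h c| ^ (1 - q) * |h i| ^ q :=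
        sum_le_sum fun i hi =>
          abs_le_rpow_mul_abs_rpow hq1 (hT c hc i (mem_compl.1 hi))
    _ = |h c| ^ (1 - q) * ∑ i ∈ Tᶜ, |h i| ^ q := (mul_sum _ _ _).symm
    _ ≤ |h c| ^ (1 - q) * ∑ i ∈ T, |h i| ^ q := by gcongr
    _ = ∑ i ∈ T, |h c| ^ (1 - q) * |h i| ^ q := mul_sum _ _ _
    _ ≤ ∑ i ∈ T, |h i| :=
        sum_le_sum fun i hi => rpow_mul_abs_rpow_le_abs hq1 (abs_nonneg _) (hmin i hi)

theorem sum_sq_pos_of_forall_le {h : Fin n → ℝ} (hh : h ≠ 0) {T : Finset (Fin n)}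
    (hne : T.Nonempty) (hT : ∀ i ∈ T, ∀ j ∉ T, |h j| ≤ |h i|) : 0 < ∑ i ∈ T, h i ^ 2 := by
  obtain ⟨i, hi⟩ : ∃ i ∈ T, h i ≠ 0 := by
    by_contra! hz
    obtain ⟨c, hc⟩ := hne
    refine hh (funext fun i => ?_)
    by_cases hi : i ∈ T
    · exact hz i hi
    · have := hT c hc i hi
      rw [hz c hc, abs_zero] at this
      exact abs_nonpos_iff.1 this
  exact sum_pos' (fun j _ => sq_nonneg (h j)) ⟨i, hi.1, by have := hi.2; positivity⟩

/-! ### The null space property under the threshold `1/3`. -/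

/-- In the application `X = ‖h_T‖²`, `N = ‖h_I‖²`, and `P + P' + 2Q = ‖A h_T‖²`. Since `b² - a² = e
k`, the selection inequality `hsel` bounds the asymmetric terms by `e²(‖A h_T‖² - X)`; after `hlow`
all terms in `e²` cancel, so odd and even `k` give the same threshold. -/
theorem third_balance {a b e k δ X N P P' Q c : ℝ} (ha : 1 ≤ a) (he0 : 0 ≤ e) (he1 : e ≤ 1)
    (hδ : 0 ≤ δ) (hb : b = a + e) (hk : a + b = k)
    (hcross : (b ^ 2 - a ^ 2) * (P - P') + 2 * a * b * (P + P' + 2 * Q) ≤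
      (b ^ 2 - a ^ 2) * (N - (X - N)) + δ * (a ^ 2 + b ^ 2) * X + 2 * δ * a * b * c)
    (hc : c ≤ X) (hsel : k * (N - (P + Q)) ≤ a * (X - (P + Q + (Q + P'))))
    (hlow : (1 - δ) * X ≤ P + P' + 2 * Q) : 2 * (a * b) * X ≤ 6 * δ * (a * b) * X := by
  subst hb hk
  have h1 := mul_le_mul_of_nonneg_left hsel he0
  have h2 := mul_le_mul_of_nonneg_left hlow (by nlinarith : 0 ≤ 2 * a * (a + e) - e ^ 2)
  have h3 := mul_le_mul_of_nonneg_left hc (by positivity : 0 ≤ δ * a * (a + e))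
  linarith

/-- If the restricted isometry constant of order `k ≥ 2` is below `1/3`, the `k` largest entries
of a nonzero kernel vector do not dominate in `ℓ¹`. -/
theorem IsRIBound.sum_abs_lt_of_lt_third {A : Matrix (Fin m) (Fin n) ℝ} {k : ℕ} {δ : ℝ}
    (hA : IsRIBound A k δ) (hk : 2 ≤ k) (hδ : δ < 1 / 3) {h : Fin n → ℝ} (hh : h ≠ 0)
    (hAh : A *ᵥ h = 0) {T : Finset (Fin n)} (hTk : #T = k)
    (hT : ∀ i ∈ T, ∀ j ∉ T, |h j| ≤ |h i|) : ∑ i ∈ T, |h i| < ∑ i ∈ Tᶜ, |h i| := by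
  by_contra! hle
  have hne : T.Nonempty := by rw [← card_pos]; omega
  have hX := sum_sq_pos_of_forall_le hh hne hT
  -- Two nearly equal halves of `k`, with `e` its parity; `k ≥ 2` is what makes the smaller half
  -- nonempty.
  obtain ⟨a, b, e, ha, hba, hab, he⟩ : ∃ a b e : ℕ, 1 ≤ a ∧ b = a + e ∧ a + b = k ∧ e ≤ 1 :=
    ⟨k / 2, k - k / 2, k - k / 2 - k / 2, by omega, by omega, by omega, by omega⟩
  have hk0 : (0 : ℝ) < k := by exact_mod_cast (by omega : 0 < k)
  set v := restrictTo Tᶜ h with hv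
  set α : ℝ := (∑ i ∈ T, |h i|) / k with hα
  have hkα : k * α = ∑ i ∈ T, |h i| := mul_div_cancel₀ _ hk0.ne'
  have hα0 : 0 ≤ α := by positivity
  have hvα : ∀ i, |v i| ≤ α := by
    intro i
    by_cases hi : i ∈ T
    · rw [hv, restrictTo_of_notMem (by simpa using hi), abs_zero]
      exact hα0
    · rw [hv, restrictTo_of_mem (by simpa using hi), hα, le_div_iff₀' hk0]
      have := card_nsmul_le_sum T (fun j => |h j|) |h i| fun j hj => hT j hj i hi
      rwa [nsmul_eq_mul, hTk] at this
  have hvsum : ∑ i, |v i| ≤ k * α := by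
    rw [hv, sum_abs_restrictTo, hkα]
    exact hle
  have hαX : k * α ^ 2 ≤ ∑ i ∈ T, h i ^ 2 := by
    have h1 := sq_sum_le_card_mul_sum_sq (s := T) (f := fun i => |h i|)
    rw [← hkα, hTk] at h1
    simp only [sq_abs] at h1
    have h2 : (k : ℝ) * (k * α ^ 2) ≤ k * ∑ i ∈ T, h i ^ 2 := by linarith
    exact le_of_mul_le_mul_left h2 hk0
  set g := Aᵀ *ᵥ (A *ᵥ restrictTo T h) with hg
  have hBg : ∀ p, A *ᵥ p ⬝ᵥ A *ᵥ restrictTo T h = p ⬝ᵥ g := by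
    intro p
    rw [hg, dotProduct_mulVec p, vecMul_transpose]
  -- The weights sum over `I` to `‖h_I‖² - ⟨A h_I, A h_T⟩`; a choice of at most average weight
  -- controls the imbalance of the two halves when `k` is odd.
  obtain ⟨I, hIT, hIa, hIavg⟩ := exists_subset_card_eq_card_mul_sum_le
    (fun i => h i ^ 2 - h i * g i) T (show a ≤ #T by omega)
  have hJb : #(T \ I) = b := by
    rw [card_sdiff_of_subset hIT]
    omega
  set p := restrictTo I h with hp
  set p' := restrictTo (T \ I) h with hp'
  have hpp : restrictTo T h = p + p' := by
    ext i
    by_cases hiI : i ∈ I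
    · simp [hp, hp', restrictTo, hiI, hIT hiI]
    · by_cases hiT : i ∈ T <;> simp [hp, hp', restrictTo, hiI, hiT]
  have hAv : A *ᵥ v = -(A *ᵥ p + A *ᵥ p') := by
    have h1 := restrictTo_add_restrictTo_compl T h
    rw [← h1, hpp, mulVec_add, mulVec_add] at hAh
    exact eq_neg_of_add_eq_zero_right hAh
  -- Scaling the tail by `c / k` makes it a combination of `c`-sparse vectors, so each half of `T`
  -- can be paired with a tail of complementary sparsity within order `k`.
  have hscale : ∀ c : ℕ, c ≤ k → (∀ i, |((c / k : ℝ) • v) i| ≤ α) ∧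
      ∑ i, |((c / k : ℝ) • v) i| ≤ c * α := by
    intro c hc
    have hck : (c : ℝ) / k ≤ 1 := (div_le_one hk0).2 (by exact_mod_cast hc)
    have hc0 : 0 ≤ (c : ℝ) / k := by positivity
    simp only [Pi.smul_apply, smul_eq_mul, abs_mul, abs_of_nonneg hc0, ← mul_sum]
    refine ⟨fun i => ?_, ?_⟩
    · nlinarith [hvα i, abs_nonneg (v i)]
    · calc (c : ℝ) / k * ∑ i, |v i| ≤ c / k * (k * α) := by gcongr
        _ = c * α := by field_simp
  have hvT : ∀ i ∈ T, v i = 0 := fun i hi => restrictTo_of_notMem (by simpa using hi) h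
  have hb := hscale b (by omega)
  have ha' := hscale a (by omega)
  -- The weights `(b, a, a)` and `(a, b, b)` make the cross terms of the two estimates add up to
  -- `2ab‖A h_T‖²`.
  have key1 := hA.cross_le (P := I) (p := p) (v := (b / k : ℝ) • v) (s := b) (β := α) (by omega)
    (fun i hi => restrictTo_of_notMem hi h)
    (fun i hi => by simp [hvT i (hIT hi)]) hb.1 hb.2 b a a
  have key2 := hA.cross_le (P := T \ I) (p := p') (v := (a / k : ℝ) • v) (s := a) (β := α)
    (by omega) (fun i hi => restrictTo_of_notMem hi h)
    (fun i hi => by simp [hvT i (mem_sdiff.1 hi).1]) ha'.1 ha'.2 a b b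
  have hlow := ((isRIBound_iff.1 hA).2 (restrictTo T h)
    ((hammingNorm_le_card fun i hi => restrictTo_of_notMem hi h).trans hTk.le)).1
  have hnorm : p ⬝ᵥ p + p' ⬝ᵥ p' = ∑ i ∈ T, h i ^ 2 := by
    rw [restrictTo_dotProduct_self, restrictTo_dotProduct_self, add_comm]
    exact sum_sdiff hIT
  have hsel : (k : ℝ) * (p ⬝ᵥ p - (A *ᵥ p ⬝ᵥ A *ᵥ p + A *ᵥ p ⬝ᵥ A *ᵥ p')) ≤
      a * (∑ i ∈ T, h i ^ 2 - A *ᵥ restrictTo T h ⬝ᵥ A *ᵥ restrictTo T h) := by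
    rw [sum_sub_distrib, sum_sub_distrib, ← restrictTo_dotProduct I h g,
      ← restrictTo_dotProduct T h g, ← hBg, ← hBg, hTk, ← restrictTo_dotProduct_self I h] at hIavg
    rw [← dotProduct_add, ← mulVec_add, ← hpp]
    exact hIavg
  rw [restrictTo_dotProduct_self] at hlow
  rw [hpp] at hlow hsel
  simp only [mulVec_smul, mulVec_add, dotProduct_smul, add_dotProduct, dotProduct_add, hAv,
    dotProduct_neg, smul_eq_mul, dotProduct_comm (A *ᵥ p') (A *ᵥ p)] at key1 key2 hlow hsel
  set X := ∑ i ∈ T, h i ^ 2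
  set P := A *ᵥ p ⬝ᵥ A *ᵥ p
  set P' := A *ᵥ p' ⬝ᵥ A *ᵥ p'
  set Q := A *ᵥ p ⬝ᵥ A *ᵥ p'
  have hδ0 : 0 ≤ δ := hA.1
  have habk : (a : ℝ) + b = k := by exact_mod_cast hab
  have hbae : (b : ℝ) = a + e := by exact_mod_cast hba
  have ha1 : (1 : ℝ) ≤ a := by exact_mod_cast ha
  have he0 : (0 : ℝ) ≤ e := e.cast_nonneg
  have he1 : (e : ℝ) ≤ 1 := by exact_mod_cast he
  have hdiv : ∀ c : ℝ, (k : ℝ) * (c / k) = c := fun c => mul_div_cancel₀ c hk0.ne'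
  have key : (b ^ 2 - a ^ 2 : ℝ) * (P - P') + 2 * a * b * (P + P' + 2 * Q) ≤
      (b ^ 2 - a ^ 2) * (p ⬝ᵥ p - p' ⬝ᵥ p') + δ * (a ^ 2 + b ^ 2) * X +
        2 * δ * a * b * (k * α ^ 2) := by
    have h1 : 2 * (a : ℝ) * (b + a) * (b / k * -(P + Q)) = -(2 * a * b * (P + Q)) := by
      rw [show (b : ℝ) + a = k by linarith]
      linear_combination (-2 * a * (P + Q)) * hdiv b
    have h2 : 2 * (b : ℝ) * (a + b) * (a / k * -(Q + P')) = -(2 * a * b * (P' + Q)) := by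
      rw [habk]
      linear_combination (-2 * b * (P' + Q)) * hdiv a
    rw [h1] at key1
    rw [h2] at key2
    rw [← habk, ← hnorm]
    linarith
  have hp'X : p' ⬝ᵥ p' = X - p ⬝ᵥ p := by linarith
  rw [hp'X] at key
  have hfin := third_balance ha1 he0 he1 hδ0 hbae habk key hαX hsel (by linarith)
  have : 0 < (a * b : ℝ) * X := by
    have : (0 : ℝ) < b := by linarith
    positivity
  nlinarith

end PartialLq

namespace PartialLq

open Finset Matrix

variable {m n : ℕ}

/-! ### The null space property under the square root threshold. -/

/-- The power mean inequality behind the `ℓ²` bound of an `ℓ^q` threshold. -/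
theorem mul_rpow_le_rpow_mul_sum_sq {q : ℝ} (hq0 : 0 < q) (hq1 : q ≤ 1) {h : Fin n → ℝ}
    {T : Finset (Fin n)} (hT : 0 < #T) {l : ℝ} (hl : 0 < l) :
    l * (((∑ i ∈ T, |h i| ^ q) / l) ^ (1 / q)) ^ 2 ≤
      (l / #T) ^ (1 - 2 / q) * ∑ i ∈ T, h i ^ 2 := by
  have hk : (0 : ℝ) < #T := by exact_mod_cast hT
  set k : ℝ := (#T : ℝ)
  set S := ∑ i ∈ T, |h i| ^ q with hS
  have hS0 : 0 ≤ S := sum_nonneg fun i _ => by positivity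
  have hmean : (S / k) ^ (2 / q) ≤ (∑ i ∈ T, h i ^ 2) / k := by
    have := Real.rpow_arith_mean_le_arith_mean_rpow T (fun _ => 1 / k) (fun i => |h i| ^ q)
      (fun _ _ => by positivity) (by rw [sum_const, nsmul_eq_mul, mul_one_div_cancel hk.ne'])
      (fun _ _ => by positivity) (p := 2 / q) (by rw [le_div_iff₀ hq0]; linarith)
    rw [← mul_sum, ← mul_sum] at this
    have hpow : ∀ i, (|h i| ^ q) ^ (2 / q) = h i ^ 2 := fun i => by
      rw [← Real.rpow_mul (abs_nonneg _), mul_div_cancel₀ _ hq0.ne', Real.rpow_two, sq_abs]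
    simp only [hpow] at this
    rwa [one_div_mul_eq_div, one_div_mul_eq_div] at this
  have hsq : ((S / l) ^ (1 / q)) ^ 2 = (k / l) ^ (2 / q) * (S / k) ^ (2 / q) := by
    rw [← Real.rpow_natCast, ← Real.rpow_mul (by positivity),
      ← Real.mul_rpow (by positivity) (by positivity)]
    congr 1
    · field_simp
    · push_cast; ring
  have hexp : (l / k) ^ (1 - 2 / q) = l / k * (k / l) ^ (2 / q) := by
    rw [Real.rpow_sub (by positivity), Real.rpow_one, div_eq_mul_inv (l / k) _,
      ← Real.inv_rpow (by positivity), inv_div]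
  calc l * ((S / l) ^ (1 / q)) ^ 2 = l * (k / l) ^ (2 / q) * (S / k) ^ (2 / q) := by
        rw [hsq]; ring
    _ ≤ l * (k / l) ^ (2 / q) * ((∑ i ∈ T, h i ^ 2) / k) := by gcongr
    _ = _ := by rw [hexp]; ring

/-- The expression is the coefficient of `‖p‖²` that remains in `cross_le` for the weights `1/2 -
μ`, `1/2`, `μ/2`. With `σ = √(c + 1)` and `μ = 1 / (σ + 1)` it equals `σ(δσ - 1) / (σ + 1)²`. -/
theorem sqrt_balance {δ c : ℝ} (hc : 0 ≤ c) (hδ : δ < 1 / √(c + 1)) :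
    ∃ μ : ℝ, μ ^ 2 - μ + δ * (1 / 2 - μ + μ ^ 2) + δ * c * μ ^ 2 / 2 < 0 := by
  have hσ : 0 < √(c + 1) := Real.sqrt_pos.2 (by linarith)
  have hσ2 : √(c + 1) ^ 2 = c + 1 := Real.sq_sqrt (by linarith)
  rw [lt_div_iff₀ hσ] at hδ
  set σ := √(c + 1)
  refine ⟨1 / (σ + 1), ?_⟩
  have hc' : c = σ ^ 2 - 1 := by linarith
  have : (1 / (σ + 1)) ^ 2 - 1 / (σ + 1) + δ * (1 / 2 - 1 / (σ + 1) + (1 / (σ + 1)) ^ 2) +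
      δ * c * (1 / (σ + 1)) ^ 2 / 2 = σ * (δ * σ - 1) / (σ + 1) ^ 2 := by
    rw [hc']
    field_simp
    ring
  rw [this]
  exact div_neg_of_neg_of_pos (mul_neg_of_pos_of_neg hσ (by linarith)) (by positivity)

/-- If the restricted isometry constant of order `k + l` is below the threshold, the `k` largest
entries of a nonzero kernel vector do not dominate in `ℓ^q`. -/
theorem IsRIBound.sum_rpow_lt_of_lt_sqrt {A : Matrix (Fin m) (Fin n) ℝ} {k l : ℕ} {δ c q : ℝ}
    (hq0 : 0 < q) (hq1 : q ≤ 1) (hk : 0 < k) (hl : 0 < l) (hA : IsRIBound A (k + l) δ)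
    (hc : ((l : ℝ) / k) ^ (1 - 2 / q) ≤ c) (hδ : δ < 1 / √(c + 1)) {h : Fin n → ℝ} (hh : h ≠ 0)
    (hAh : A *ᵥ h = 0) {T : Finset (Fin n)} (hTk : #T = k)
    (hT : ∀ i ∈ T, ∀ j ∉ T, |h j| ≤ |h i|) : ∑ i ∈ T, |h i| ^ q < ∑ i ∈ Tᶜ, |h i| ^ q := by
  by_contra! hle
  have hne : T.Nonempty := by rw [← card_pos]; omega
  have hX := sum_sq_pos_of_forall_le hh hne hT
  have hl0 : (0 : ℝ) < l := by exact_mod_cast hl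
  have hc0 : 0 ≤ c := le_trans (by positivity) hc
  set S := ∑ i ∈ T, |h i| ^ q with hS
  have hS0 : 0 < S := by
    obtain ⟨i, hi, hi0⟩ := exists_ne_zero_of_sum_ne_zero hX.ne'
    have : h i ≠ 0 := fun h0 => hi0 (by simp [h0])
    exact sum_pos' (fun j _ => by positivity) ⟨i, hi, by positivity⟩
  -- Normalised by `l * β ^ q = S`: since the tail has `ℓ^q` mass at most `S`, at most `l` of its
  -- entries exceed `β`.
  set β := (S / l) ^ (1 / q) with hβ
  have hβ0 : 0 < β := by positivity
  have hβq : l * β ^ q = S := by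
    rw [hβ, ← Real.rpow_mul (by positivity), one_div_mul_cancel hq0.ne', Real.rpow_one,
      mul_div_cancel₀ _ hl0.ne']
  have hβX : l * β ^ 2 ≤ c * ∑ i ∈ T, h i ^ 2 := by
    refine (mul_rpow_le_rpow_mul_sum_sq hq0 hq1 (by omega) hl0).trans ?_
    rw [hTk]
    gcongr
  set T₁ : Finset (Fin n) := {i ∈ Tᶜ | β < |h i|} with hT₁
  set T₂ : Finset (Fin n) := {i ∈ Tᶜ | ¬ β < |h i|} with hT₂
  have hsplit : ∑ i ∈ T₁, |h i| ^ q + ∑ i ∈ T₂, |h i| ^ q = ∑ i ∈ Tᶜ, |h i| ^ q :=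
    sum_filter_add_sum_filter_not _ _ _
  have hT₁sum : #T₁ * β ^ q ≤ ∑ i ∈ T₁, |h i| ^ q := by
    rw [← nsmul_eq_mul]
    exact card_nsmul_le_sum _ _ _ fun i hi =>
      Real.rpow_le_rpow hβ0.le (mem_filter.1 hi).2.le hq0.le
  have hβq0 : 0 < β ^ q := by positivity
  have hT₂0 : 0 ≤ ∑ i ∈ T₂, |h i| ^ q := sum_nonneg fun i _ => by positivity
  have hT₁l : #T₁ ≤ l := by
    have : (#T₁ : ℝ) * β ^ q ≤ l * β ^ q := by linarith
    exact_mod_cast le_of_mul_le_mul_right this hβq0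
  -- The large tail entries join the head, and what they leave of the budget `l` is the sparsity `s`
  -- available for the rest.
  obtain ⟨s, hs⟩ := Nat.exists_eq_add_of_le hT₁l
  have hs' : (l : ℝ) = #T₁ + s := by exact_mod_cast hs
  have hT₂le : ∀ i ∈ T₂, |h i| ≤ β := fun i hi => not_lt.1 (mem_filter.1 hi).2
  have hT₂sum : ∑ i ∈ T₂, |h i| ≤ s * β := by
    calc ∑ i ∈ T₂, |h i| ≤ ∑ i ∈ T₂, β ^ (1 - q) * |h i| ^ q :=
          sum_le_sum fun i hi => abs_le_rpow_mul_abs_rpow hq1 (hT₂le i hi)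
      _ = β ^ (1 - q) * ∑ i ∈ T₂, |h i| ^ q := (mul_sum _ _ _).symm
      _ ≤ β ^ (1 - q) * (s * β ^ q) := by
          gcongr
          rw [hs'] at hβq
          linarith
      _ = s * (β ^ (1 - q) * β ^ q) := by ring
      _ = s * β := by rw [← Real.rpow_add hβ0, sub_add_cancel, Real.rpow_one]
  have hcompl : (T ∪ T₁)ᶜ = T₂ := by
    ext i
    simp only [hT₁, hT₂, mem_compl, mem_union, mem_filter]
    tauto
  set p := restrictTo (T ∪ T₁) h with hp
  have hAv : A *ᵥ restrictTo T₂ h = -(A *ᵥ p) := by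
    have h1 := restrictTo_add_restrictTo_compl (T ∪ T₁) h
    rw [hcompl] at h1
    rw [← h1, mulVec_add] at hAh
    exact eq_neg_of_add_eq_zero_right hAh
  have hpX : ∑ i ∈ T, h i ^ 2 ≤ p ⬝ᵥ p := by
    rw [hp, restrictTo_dotProduct_self]
    exact sum_le_sum_of_subset_of_nonneg subset_union_left fun i _ _ => sq_nonneg _
  obtain ⟨μ, hμ⟩ := sqrt_balance hc0 hδ
  -- As `A v = -A p`, these weights cancel `‖A p‖²` entirely: its coefficient is `(μ² - μ) + μ(1 -
  -- μ)`.
  have key := hA.cross_le (P := T ∪ T₁) (p := p) (v := restrictTo T₂ h) (s := s) (β := β)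
    (by have := card_union_le T T₁; omega) (fun i hi => restrictTo_of_notMem hi h)
    (fun i hi => restrictTo_of_notMem (by rwa [← hcompl, mem_compl, not_not]) h)
    (fun i => by
      by_cases hi : i ∈ T₂
      · rw [restrictTo_of_mem hi]; exact hT₂le i hi
      · rw [restrictTo_of_notMem hi, abs_zero]; exact hβ0.le)
    (by rw [sum_abs_restrictTo]; exact hT₂sum) (1 / 2 - μ) (1 / 2) (μ / 2)
  rw [hAv, dotProduct_neg] at key
  have hsβ : δ * μ ^ 2 / 2 * (s * β ^ 2) ≤ δ * μ ^ 2 / 2 * (c * (p ⬝ᵥ p)) := by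
    have hδ0 := hA.1
    refine mul_le_mul_of_nonneg_left ?_ (by positivity)
    calc (s : ℝ) * β ^ 2 ≤ l * β ^ 2 := by
          gcongr
          omega
      _ ≤ c * ∑ i ∈ T, h i ^ 2 := hβX
      _ ≤ c * (p ⬝ᵥ p) := by gcongr
  have := mul_neg_of_neg_of_pos hμ (hX.trans_le hpX)
  linarith

/-! ### From the null space property to the partial regularizer. -/

/-- The null space property follows from its instance for the largest entries. -/
theorem sum_rpow_lt_sum_rpow_compl {q : ℝ} (hq0 : 0 < q) {h : Fin n → ℝ} {k : ℕ} (hkn : k ≤ n)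
    (hlt : ∀ T : Finset (Fin n), #T = k → (∀ i ∈ T, ∀ j ∉ T, |h j| ≤ |h i|) →
      ∑ i ∈ T, |h i| ^ q < ∑ i ∈ Tᶜ, |h i| ^ q)
    {U : Finset (Fin n)} (hU : #U ≤ k) : ∑ i ∈ U, |h i| ^ q < ∑ i ∈ Uᶜ, |h i| ^ q := by
  obtain ⟨T, -, hTk, hT⟩ := exists_subset_card_eq_forall_le (fun i => |h i|) univ k (by simpa)
  have hT' : ∀ i ∈ T, ∀ j ∉ T, |h j| ≤ |h i| := fun i hi j hj => hT i hi j (mem_univ j) hj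
  have h1 := hlt T hTk hT'
  have h2 : ∑ i ∈ U, |h i| ^ q ≤ ∑ i ∈ T, |h i| ^ q :=
    sum_le_sum_of_forall_le (fun i => by positivity) (by omega) fun i hi j hj =>
      Real.rpow_le_rpow (abs_nonneg _) (hT' i hi j hj) hq0.le
  have h3 := sum_add_sum_compl T fun i => |h i| ^ q
  have h4 := sum_add_sum_compl U fun i => |h i| ^ q
  linarith

/-- The partial regularizer omits a set of at most `r` coordinates carrying the largest
absolute values. -/
theorem exists_partialReg_eq (φ : ℝ → ℝ) {r : ℕ} (hr : r ≤ n) (x : Fin n → ℝ) :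
    ∃ T : Finset (Fin n), #T = r ∧ (∀ i ∈ T, ∀ j ∉ T, |x j| ≤ |x i|) ∧
      partialReg φ r x = ∑ i ∈ Tᶜ, φ |x i| := by
  set σ := Tuple.sort fun j => -|x j| with hσ
  refine ⟨({i : Fin n | (i : ℕ) < r} : Finset (Fin n)).map σ.toEmbedding, ?_, ?_, ?_⟩
  · rw [card_map, Fin.card_filter_val_lt, min_eq_right hr]
  · intro i hi j hj
    simp only [mem_map_equiv, mem_filter, mem_univ, true_and, not_lt] at hi hj
    have := absSorted_antitone x (show σ.symm i ≤ σ.symm j from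
      Fin.le_def.2 (hi.le.trans hj))
    simpa [absSorted, ← hσ] using this
  · have hc : (({i : Fin n | (i : ℕ) < r} : Finset (Fin n)).map σ.toEmbedding)ᶜ =
        ({i : Fin n | r ≤ (i : ℕ)} : Finset (Fin n)).map σ.toEmbedding := by
      ext i
      simp [mem_map_equiv]
    rw [hc, sum_map]
    rfl

/-- Discarding the `r` largest entries leaves the least mass among all ways of discarding `r`
entries. -/
theorem partialReg_rpow_le {q : ℝ} (hq0 : 0 < q) {r : ℕ} (x : Fin n → ℝ)
    {U : Finset (Fin n)} (hU : #U = r) :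
    partialReg (fun t => |t| ^ q) r x ≤ ∑ i ∈ Uᶜ, |x i| ^ q := by
  obtain ⟨T, hTr, hT, hreg⟩ := exists_partialReg_eq (fun t => |t| ^ q)
    (hU ▸ card_finset_fin_le U : r ≤ n) x
  simp only [abs_abs] at hreg
  rw [hreg]
  have h2 : ∑ i ∈ U, |x i| ^ q ≤ ∑ i ∈ T, |x i| ^ q :=
    sum_le_sum_of_forall_le (fun i => by positivity) (by omega) fun i hi j hj =>
      Real.rpow_le_rpow (abs_nonneg _) (hT i hi j hj) hq0.le
  have h3 := sum_add_sum_compl T fun i => |x i| ^ q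
  have h4 := sum_add_sum_compl U fun i => |x i| ^ q
  linarith

/-- The null space property of order `‖x‖₀` at `y - x` makes the partial `ℓ^q` regularizer
strictly larger at `y` than at `x`. -/
theorem partialReg_rpow_lt {q : ℝ} (hq0 : 0 < q) (hq1 : q ≤ 1) {x y : Fin n → ℝ} {r : ℕ}
    (hr : r ≤ hammingNorm x)
    (hnsp : ∀ U : Finset (Fin n), #U ≤ hammingNorm x →
      ∑ i ∈ U, |y i - x i| ^ q < ∑ i ∈ Uᶜ, |y i - x i| ^ q) :
    partialReg (fun t => |t| ^ q) r x < partialReg (fun t => |t| ^ q) r y := by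
  set S : Finset (Fin n) := {i | x i ≠ 0} with hS
  have hSK : #S = hammingNorm x := rfl
  obtain ⟨T, hTr, -, hreg⟩ := exists_partialReg_eq (fun t => |t| ^ q)
    ((hr.trans hSK.ge).trans (card_finset_fin_le S)) y
  simp only [abs_abs] at hreg
  -- `T'` is discarded for `x` in place of `T`. It contains `T ∩ S`, so `S \ T'` avoids `T` and is
  -- still counted for `y`.
  obtain ⟨T', hTT', hT'S, hT'r⟩ := exists_subsuperset_card_eq
    (inter_subset_right : T ∩ S ⊆ S) ((card_le_card inter_subset_left).trans hTr.le)
    (hr.trans hSK.ge)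
  set f : Fin n → ℝ := fun i => |y i - x i| ^ q with hf
  set R := (S ∪ T)ᶜ with hR
  have hx0 : ∀ i ∉ S, x i = 0 := fun i hi => by simpa [hS] using hi
  have hxle : partialReg (fun t => |t| ^ q) r x ≤ ∑ i ∈ S \ T', |x i| ^ q := by
    refine (partialReg_rpow_le hq0 x hT'r).trans_eq (sum_subset ?_ ?_).symm
    · intro i hi
      exact mem_compl.2 (mem_sdiff.1 hi).2
    · intro i hi hi'
      have : i ∉ S := fun hiS => hi' (mem_sdiff.2 ⟨hiS, mem_compl.1 hi⟩)
      rw [hx0 i this, abs_zero, Real.zero_rpow hq0.ne']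
  have hyge : ∑ i ∈ S \ T', |y i| ^ q + ∑ i ∈ R, f i ≤ ∑ i ∈ Tᶜ, |y i| ^ q := by
    have hdisj : Disjoint (S \ T') R := by
      rw [disjoint_left]
      intro i hi hiR
      exact mem_compl.1 hiR (mem_union_left _ (mem_sdiff.1 hi).1)
    rw [sum_congr rfl (fun i hi => ?_ : ∀ i ∈ R, f i = |y i| ^ q), ← sum_union hdisj]
    · refine sum_le_sum_of_subset_of_nonneg (fun i hi => ?_) fun i _ _ => by positivity
      rw [mem_compl]
      intro hiT
      rcases mem_union.1 hi with hi | hi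
      · exact (mem_sdiff.1 hi).2 (hTT' (mem_inter.2 ⟨hiT, (mem_sdiff.1 hi).1⟩))
      · exact mem_compl.1 hi (mem_union_right _ hiT)
    · rw [hf]
      simp only
      rw [hx0 i fun hiS => mem_compl.1 hi (mem_union_left _ hiS), sub_zero]
  have htri : ∑ i ∈ S \ T', |x i| ^ q ≤ ∑ i ∈ S \ T', |y i| ^ q + ∑ i ∈ S \ T', f i := by
    rw [← sum_add_distrib]
    refine sum_le_sum fun i _ => ?_
    calc |x i| ^ q ≤ (|y i| + |y i - x i|) ^ q := by
          refine Real.rpow_le_rpow (abs_nonneg _) ?_ hq0.le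
          have := abs_sub (y i) (y i - x i)
          rwa [sub_sub_cancel] at this
      _ ≤ |y i| ^ q + |y i - x i| ^ q :=
          Real.rpow_add_le_add_rpow (abs_nonneg _) (abs_nonneg _) hq0.le hq1
  have hST : ∑ i ∈ S \ T', f i + ∑ i ∈ T', f i = ∑ i ∈ S, f i := sum_sdiff hT'S
  have hTS : ∑ i ∈ S, f i + ∑ i ∈ T \ S, f i = ∑ i ∈ S ∪ T, f i := by
    rw [← union_sdiff_self_eq_union, sum_union disjoint_sdiff]
  have hall := sum_add_sum_compl (S ∪ T) f
  -- The null space property is applied to `S \ T'` together with the heavier of `T'` and `T \ S`;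
  -- the lighter one is left in the complement beside `R`. Both have at most `r` elements, so order
  -- `‖x‖₀` suffices.
  have hmain : ∑ i ∈ S \ T', f i < ∑ i ∈ R, f i := by
    rcases le_total (∑ i ∈ T \ S, f i) (∑ i ∈ T', f i) with hle | hle
    · have h1 := hnsp S hSK.le
      have h2 := sum_add_sum_compl S f
      linarith
    · have hdisj : Disjoint (S \ T') (T \ S) :=
        disjoint_sdiff.mono_left sdiff_subset
      have hcard : #(S \ T' ∪ T \ S) ≤ hammingNorm x := by
        refine (card_union_le _ _).trans ?_
        have h1 : #(T \ S) ≤ r := (card_le_card sdiff_subset).trans hTr.le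
        rw [card_sdiff_of_subset hT'S]
        omega
      have h1 := hnsp _ hcard
      have h2 := sum_add_sum_compl (S \ T' ∪ T \ S) f
      have h3 := sum_union hdisj (f := f)
      linarith
  rw [hreg]
  linarith

theorem IsSparsestSolution.hammingNorm_eq {A : Matrix (Fin m) (Fin n) ℝ} {b : Fin m → ℝ}
    {x : Fin n → ℝ} (hx : IsSparsestSolution A b x) : hammingNorm x = minCard A b := by
  refine le_antisymm (le_csInf ⟨_, x, hx.1, rfl⟩ ?_) (Nat.sInf_le ⟨x, hx.1, rfl⟩)
  rintro _ ⟨y, hy, rfl⟩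
  exact hx.2 y hy

/-! ### Both thresholds assembled. -/

/-- The null space property of order `k` under a bound on the restricted isometry constant of
order `k`. -/
theorem IsRIBound.nullSpace_of_lt_third {A : Matrix (Fin m) (Fin n) ℝ} {k : ℕ} {δ q : ℝ}
    (hq0 : 0 < q) (hq1 : q ≤ 1) (hA : IsRIBound A k δ) (hk : 2 ≤ k) (hkn : k ≤ n)
    (hδ : δ < 1 / 3) {h : Fin n → ℝ} (hh : h ≠ 0) (hAh : A *ᵥ h = 0) {U : Finset (Fin n)}
    (hU : #U ≤ k) : ∑ i ∈ U, |h i| ^ q < ∑ i ∈ Uᶜ, |h i| ^ q := by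
  refine sum_rpow_lt_sum_rpow_compl hq0 hkn (fun T hTk hT => ?_) hU
  by_contra! hle
  have hne : T.Nonempty := by rw [← card_pos]; omega
  exact (hA.sum_abs_lt_of_lt_third hk hδ hh hAh hTk hT).not_ge
    (sum_abs_compl_le_of_sum_rpow_compl_le hq1 hne hT hle)

/-- The null space property of order `k` under a bound on the restricted isometry constant of
order `γ k` with `γ > 1`. -/
theorem IsRIBound.nullSpace_of_lt_sqrt {A : Matrix (Fin m) (Fin n) ℝ} {k : ℕ} {δ q γ : ℝ}
    (hq0 : 0 < q) (hq1 : q ≤ 1) (hγ : 1 < γ) (hA : IsRIBound A ⌈γ * k⌉₊ δ) (hkn : k ≤ n)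
    (hδ : δ < 1 / √((γ - 1) ^ (1 - 2 / q) + 1)) {h : Fin n → ℝ} (hh : h ≠ 0) (hAh : A *ᵥ h = 0)
    {U : Finset (Fin n)} (hU : #U ≤ k) : ∑ i ∈ U, |h i| ^ q < ∑ i ∈ Uᶜ, |h i| ^ q := by
  rcases Nat.eq_zero_or_pos k with rfl | hk
  · rw [card_eq_zero.1 (Nat.le_zero.1 hU), sum_empty, compl_empty]
    obtain ⟨i, hi⟩ := Function.ne_iff.1 hh
    have : h i ≠ 0 := hi
    exact sum_pos' (fun j _ => by positivity) ⟨i, mem_univ i, by positivity⟩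
  · have hk0 : (0 : ℝ) < k := by exact_mod_cast hk
    have hlt : k < ⌈γ * k⌉₊ := Nat.lt_ceil.2 (by nlinarith)
    obtain ⟨l, hl⟩ := Nat.exists_eq_add_of_lt hlt
    rw [add_assoc] at hl
    have hle : γ - 1 ≤ ((l + 1 : ℕ) : ℝ) / k := by
      rw [le_div_iff₀ hk0]
      have h1 := Nat.le_ceil (γ * k)
      rw [hl, Nat.cast_add] at h1
      linarith
    rw [hl] at hA
    refine sum_rpow_lt_sum_rpow_compl hq0 hkn (fun T hTk hT => ?_) hU
    refine hA.sum_rpow_lt_of_lt_sqrt hq0 hq1 hk l.succ_pos ?_ hδ hh hAh hTk hT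
    -- The exponent `1 - 2/q` is negative, so rounding `γ k` up only lowers the constant.
    refine Real.rpow_le_rpow_of_nonpos (by linarith) hle ?_
    rw [sub_nonpos, le_div_iff₀ hq0]
    linarith

end PartialLq

theorem theorem4p4 {m n : ℕ} (A : Matrix (Fin m) (Fin n) ℝ) (b : Fin m → ℝ)
    (q : ℝ) (hq0 : 0 < q) (hq1 : q ≤ 1)
    (r : ℕ) (hr : r ≤ PartialLq.minCard A b)
    (hδ : (2 ≤ PartialLq.minCard A b + r / 2 ∧
            PartialLq.ric A (PartialLq.minCard A b + r / 2) < 1 / 3) ∨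
          (∃ γ : ℝ, 1 < γ ∧
            PartialLq.ricReal A (γ * ((PartialLq.minCard A b + r / 2 : ℕ) : ℝ)) <
              1 / Real.sqrt ((γ - 1) ^ (1 - 2 / q) + 1)))
    (x : Fin n → ℝ) (hx : PartialLq.IsSparsestSolution A b x) :
    PartialLq.IsUniqueGlobalMin A b (fun t : ℝ => |t| ^ q) r x := by
  have hK := hx.hammingNorm_eq
  have hKn : PartialLq.minCard A b ≤ n := by
    rw [← hK]
    exact card_finset_fin_le _
  refine ⟨hx.1, fun y hy hyx => ?_⟩
  have hh : y - x ≠ 0 := sub_ne_zero.2 hyx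
  have hAh : A.mulVec (y - x) = 0 := by rw [Matrix.mulVec_sub, hy, hx.1, sub_self]
  refine PartialLq.partialReg_rpow_lt hq0 hq1 (hr.trans hK.ge) fun U hU => ?_
  rw [hK] at hU
  rcases hδ with ⟨h2, hδ⟩ | ⟨γ, hγ, hδ⟩
  · have hA := (PartialLq.ric_isLeast A (PartialLq.minCard A b + r / 2)).1.mono
      (Nat.le_add_right _ _)
    -- `K + ⌊r/2⌋ ≥ 2` forces `K ≥ 2`, since `r ≤ K ≤ 1` would give `⌊r/2⌋ = 0`.
    exact hA.nullSpace_of_lt_third hq0 hq1 (by omega) hKn hδ hh hAh hU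
  · have hA := (PartialLq.ric_isLeast A
      ⌈γ * ((PartialLq.minCard A b + r / 2 : ℕ) : ℝ)⌉₊).1.mono
      (k := ⌈γ * (PartialLq.minCard A b : ℝ)⌉₊) (by
        refine Nat.ceil_mono (mul_le_mul_of_nonneg_left ?_ (by linarith))
        exact_mod_cast Nat.le_add_right _ _)
    exact hA.nullSpace_of_lt_sqrt hq0 hq1 hγ hKn hδ hh hAh hU
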